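/- Let $\mathcal H$ be a complex separable Hilbert space with an orthonormal basis $(|n\rangle)_{n\ge 0}$. For a Borel set $X\subseteq[0,2\pi)$ let $$E_{\rm can}(X)=\sum_{n,m=0}^\infty \frac{1}{2\pi}\int_X e^{i(n-m)x}\,dx\;|n\rangle\langle m|,$$ the bounded operator on $\mathcal H$ to which the rectangular partial sums of the double series converge strongly (the canonical phase). Then for every Borel set $X\subseteq[0,2\pi)$ with $E_{\rm can}(X)\neq I$ and every unit vector $\varphi\in\mathcal H$, the number $\langle\varphi\,|\,E_{\rm can}(X)\varphi\rangle$ is real and $$\langle\varphi\,|\,E_{\rm can}(X)\varphi\rangle<1 .$$ -/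

import Mathlib

open MeasureTheory Filter Topology

noncomputable section

/-- Lebesgue measure on the interval `[0, 2π)`. -/
abbrev lebesgueIco : Measure (Set.Ico (0 : ℝ) (2 * Real.pi)) :=
  Measure.comap Subtype.val volume

/-- The number `(1 / 2π) ∫_X e^{i(n-m)x} dx` for a subset `X` of the interval `[0, 2π)`, the integral
being taken with respect to Lebesgue measure on `[0, 2π)`. -/
def canonicalPhaseCoeff (X : Set (Set.Ico (0 : ℝ) (2 * Real.pi))) (n m : ℕ) : ℂ :=
  (1 / (2 * Real.pi) : ℂ) * ∫ x in X,
    Complex.exp (Complex.I * ((n : ℂ) - (m : ℂ)) * ((x : ℝ) : ℂ)) ∂lebesgueIco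

/-- The partial sum `∑_{n < k, m < l} (1 / 2π) ∫_X e^{i(n-m)x} dx |n⟩⟨m|`, where `|n⟩ = b n`
and `|n⟩⟨m|` is the rank one operator `φ ↦ ⟨m|φ⟩ |n⟩`. -/
def canonicalPhasePartialSum {H : Type*} [NormedAddCommGroup H] [InnerProductSpace ℂ H]
    (b : HilbertBasis ℕ ℂ H) (X : Set (Set.Ico (0 : ℝ) (2 * Real.pi))) (k l : ℕ) : H →L[ℂ] H :=
  ∑ n ∈ Finset.range k, ∑ m ∈ Finset.range l,
    canonicalPhaseCoeff X n m • InnerProductSpace.rankOne ℂ (b n) (b m)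

/-- The normalised exponential `x ↦ e^{-inx} / √(2π)` as an element of `L²([0, 2π))`; auxiliary. -/
def canonicalPhaseExp (n : ℕ) :
    Lp ℂ 2 lebesgueIco :=
  MemLp.toLp
    (fun x => ((Real.sqrt (2 * Real.pi))⁻¹ : ℂ) *
      Complex.exp (-(Complex.I * (n : ℂ) * ((x : ℝ) : ℂ)))) (by
    have : IsFiniteMeasure lebesgueIco :=
      ⟨by rw [comap_subtype_coe_apply measurableSet_Ico, Set.image_univ, Subtype.range_coe,
        Real.volume_Ico]; exact ENNReal.ofReal_lt_top⟩
    refine MemLp.of_bound (C := (Real.sqrt (2 * Real.pi))⁻¹) ?_ ?_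
    · refine Continuous.aestronglyMeasurable ?_
      fun_prop
    · refine Eventually.of_forall fun x => ?_
      rw [norm_mul, Complex.norm_exp]
      simp [abs_of_nonneg (Real.sqrt_nonneg _)])

lemma canonicalPhaseExp_inner (X : Set (Set.Ico (0 : ℝ) (2 * Real.pi))) (n m : ℕ) :
    inner ℂ (LpToLpRestrictCLM _ ℂ ℂ lebesgueIco 2 X (canonicalPhaseExp n))
      (LpToLpRestrictCLM _ ℂ ℂ lebesgueIco 2 X (canonicalPhaseExp m)) = canonicalPhaseCoeff X n m := by
  have key : ∀ j : ℕ, LpToLpRestrictCLM _ ℂ ℂ lebesgueIco 2 X (canonicalPhaseExp j)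
      =ᵐ[lebesgueIco.restrict X] fun x => ((Real.sqrt (2 * Real.pi))⁻¹ : ℂ) *
      Complex.exp (-(Complex.I * (j : ℂ) * ((x : ℝ) : ℂ))) := fun j =>
    (LpToLpRestrictCLM_coeFn ℂ X _).trans (ae_restrict_of_ae (MemLp.coeFn_toLp _))
  rw [L2.inner_def, canonicalPhaseCoeff, ← integral_const_mul]
  refine integral_congr_ae ?_
  filter_upwards [key n, key m] with x hn hm
  rw [hn, hm, RCLike.inner_apply, map_mul, ← Complex.exp_conj]
  have h2 : ((Real.sqrt (2 * Real.pi) : ℂ))⁻¹ * ((Real.sqrt (2 * Real.pi) : ℂ))⁻¹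
      = 1 / (2 * Real.pi) := by
    rw [← mul_inv, ← Complex.ofReal_mul, Real.mul_self_sqrt (by positivity)]
    push_cast
    rw [one_div]
  rw [← h2]
  simp only [map_inv₀, Complex.conj_ofReal, map_neg, map_mul, Complex.conj_I, map_natCast]
  have h3 : Complex.exp (Complex.I * ((n : ℂ) - m) * ((x : ℝ) : ℂ))
      = Complex.exp (-(Complex.I * (m : ℂ) * ((x : ℝ) : ℂ))) *
        Complex.exp (-(-Complex.I * (n : ℂ) * ((x : ℝ) : ℂ))) := by
    rw [← Complex.exp_add]
    congr 1
    ring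
  rw [h3]
  ring

lemma canonicalPhaseCoeff_univ (n m : ℕ) :
    canonicalPhaseCoeff Set.univ n m = if n = m then 1 else 0 := by
  have hpi : (Real.pi : ℂ) ≠ 0 := by exact_mod_cast Real.pi_ne_zero
  rw [canonicalPhaseCoeff, Measure.restrict_univ,
    integral_subtype_comap measurableSet_Ico
      (fun x : ℝ => Complex.exp (Complex.I * ((n : ℂ) - (m : ℂ)) * (x : ℂ))),
    integral_Ico_eq_integral_Ioc, ← intervalIntegral.integral_of_le (by positivity)]
  split_ifs with h
  · subst h
    simp
    field_simp
  · have h0 : ((n : ℂ) - m) ≠ 0 := sub_ne_zero.mpr (by exact_mod_cast h)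
    rw [integral_exp_mul_complex (mul_ne_zero Complex.I_ne_zero h0)]
    have h1 : Complex.exp (Complex.I * ((n : ℂ) - m) * ((2 * Real.pi : ℝ) : ℂ)) = 1 := by
      rw [Complex.exp_eq_one_iff]
      exact ⟨(n : ℤ) - m, by push_cast; ring⟩
    rw [h1]
    simp

lemma canonicalPhaseExp_orthonormal : Orthonormal ℂ canonicalPhaseExp := by
  rw [orthonormal_iff_ite]
  intro n m
  rw [← canonicalPhaseCoeff_univ, ← canonicalPhaseExp_inner, L2.inner_def, L2.inner_def]
  have key : ∀ j : ℕ, LpToLpRestrictCLM _ ℂ ℂ lebesgueIco 2 Set.univ (canonicalPhaseExp j)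
      =ᵐ[lebesgueIco.restrict Set.univ] canonicalPhaseExp j := fun j =>
    LpToLpRestrictCLM_coeFn ℂ Set.univ _
  refine setIntegral_univ.symm.trans (integral_congr_ae ?_)
  filter_upwards [key n, key m] with x hn hm
  rw [hn, hm]

/-- The double series `∑_{n,m} (1 / 2π) ∫_X e^{i(n-m)x} dx |n⟩⟨m|` converges strongly to a
(unique) bounded operator. -/
lemma canonicalPhase_existsUnique {H : Type*} [NormedAddCommGroup H] [InnerProductSpace ℂ H]
    [CompleteSpace H] (b : HilbertBasis ℕ ℂ H) (X : Set (Set.Ico (0 : ℝ) (2 * Real.pi))) :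
    ∃! T : H →L[ℂ] H, ∀ φ : H,
      Tendsto (fun p : ℕ × ℕ => canonicalPhasePartialSum b X p.1 p.2 φ) atTop (𝓝 (T φ)) := by
  let J : H →L[ℂ] Lp ℂ 2 lebesgueIco :=
    (canonicalPhaseExp_orthonormal.orthogonalFamily.linearIsometry.comp
      b.repr.toLinearIsometry).toContinuousLinearMap
  have hJ : ∀ n, J (b n) = canonicalPhaseExp n := by
    intro n
    have : J (b n) = canonicalPhaseExp_orthonormal.orthogonalFamily.linearIsometry
        (b.repr (b n)) := rfl
    rw [this, b.repr_self, OrthogonalFamily.linearIsometry_apply_single]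
    simp
  let A := (LpToLpRestrictCLM _ ℂ ℂ lebesgueIco 2 X).comp J
  let T : H →L[ℂ] H := (ContinuousLinearMap.adjoint A).comp A
  have hT : ∀ n m, inner ℂ (b n) (T (b m)) = canonicalPhaseCoeff X n m := by
    intro n m
    rw [← canonicalPhaseExp_inner, ← hJ, ← hJ]
    exact ContinuousLinearMap.adjoint_inner_right A _ _
  -- the orthogonal projections onto the first `k` basis vectors
  let P : ℕ → H →L[ℂ] H := fun k =>
    ∑ n ∈ Finset.range k, InnerProductSpace.rankOne ℂ (b n) (b n)
  have hP : ∀ φ, Tendsto (fun k => P k φ) atTop (𝓝 φ) := by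
    intro φ
    have := (b.hasSum_repr φ).tendsto_sum_nat
    simpa [P, sum_apply, b.repr_apply_apply] using this
  have hP1 : ∀ k φ, ‖P k φ‖ ≤ ‖φ‖ := by
    intro k φ
    have h1 : P k φ = ∑ n ∈ Finset.range k, inner ℂ (b n) φ • b n := by
      simp [P]
    have h2 : ‖P k φ‖ ^ 2 ≤ ‖φ‖ ^ 2 := by
      rw [h1, @norm_sq_eq_re_inner ℂ, b.orthonormal.inner_sum]
      refine le_trans (le_of_eq ?_) (b.orthonormal.sum_inner_products_le φ (s := Finset.range k))
      rw [map_sum]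
      refine Finset.sum_congr rfl fun i _ => ?_
      rw [RCLike.conj_mul]
      norm_cast
    exact (pow_le_pow_iff_left₀ (norm_nonneg _) (norm_nonneg _) two_ne_zero).mp h2
  have hS : ∀ k l φ, canonicalPhasePartialSum b X k l φ = P k (T (P l φ)) := by
    intro k l φ
    simp only [canonicalPhasePartialSum, P, sum_apply, map_sum,
      smul_apply, InnerProductSpace.rankOne_apply, map_smul, hT, smul_smul]
    rw [Finset.sum_comm]
    refine Finset.sum_congr rfl fun m _ => ?_
    rw [Finset.smul_sum]
    refine Finset.sum_congr rfl fun n _ => ?_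
    rw [smul_smul, mul_comm]
  have hlim : ∀ φ : H,
      Tendsto (fun p : ℕ × ℕ => canonicalPhasePartialSum b X p.1 p.2 φ) atTop (𝓝 (T φ)) := by
    intro φ
    simp only [hS]
    rw [← prod_atTop_atTop_eq]
    have h1 : Tendsto (fun p : ℕ × ℕ => P p.1 (T (P p.2 φ) - T φ)) (atTop ×ˢ atTop) (𝓝 0) := by
      have h2 : Tendsto (fun l => ‖T (P l φ) - T φ‖) atTop (𝓝 0) :=
        tendsto_iff_norm_sub_tendsto_zero.mp ((T.continuous.tendsto φ).comp (hP φ))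
      exact squeeze_zero_norm (fun p => hP1 _ _) (h2.comp tendsto_snd)
    have h3 : Tendsto (fun p : ℕ × ℕ => P p.1 (T φ)) (atTop ×ˢ atTop) (𝓝 (T φ)) :=
      (hP (T φ)).comp tendsto_fst
    have h4 := h1.add h3
    rw [zero_add] at h4
    refine h4.congr fun p => ?_
    rw [← map_add, sub_add_cancel]
  refine ⟨T, hlim, fun T' hT' => ?_⟩
  ext φ
  exact tendsto_nhds_unique (hT' φ) (hlim φ)

/-- The canonical phase `E_can(X) = ∑_{n,m} (1 / 2π) ∫_X e^{i(n-m)x} dx |n⟩⟨m|` associated with the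
orthonormal basis `|n⟩ = b n`: the bounded operator to which the double series converges in the
strong operator topology. -/
def canonicalPhase {H : Type*} [NormedAddCommGroup H] [InnerProductSpace ℂ H] [CompleteSpace H]
    (b : HilbertBasis ℕ ℂ H) (X : Set (Set.Ico (0 : ℝ) (2 * Real.pi))) : H →L[ℂ] H :=
  (canonicalPhase_existsUnique b X).choose

lemma tendsto_canonicalPhasePartialSum {H : Type*} [NormedAddCommGroup H]
    [InnerProductSpace ℂ H] [CompleteSpace H] (b : HilbertBasis ℕ ℂ H)
    (X : Set (Set.Ico (0 : ℝ) (2 * Real.pi))) (φ : H) :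
    Tendsto (fun p : ℕ × ℕ => canonicalPhasePartialSum b X p.1 p.2 φ) atTop
      (𝓝 (canonicalPhase b X φ)) :=
  (canonicalPhase_existsUnique b X).choose_spec.1 φ

end

/-! With `c n = ⟨n|φ⟩` and `f_N = ∑_{n<N} c n e^{-inx}`, the number `⟨φ|E_can(X)φ⟩` is the limit of
the reals `(1/2π) ∫_X |f_N|²`, which Bessel bounds by `1`. If the limit is `1`, then `∫_{Xᶜ} |f_N|²
→ 0`. Since `E_can(X) ≠ I`, the set `Xᶜ` has positive measure, so `φ` corresponds to a Hardy
function vanishing there and must be `0`.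

That uniqueness theorem (`eq_zero_of_tendsto_setIntegral_antianalyticSum`) is proved without
boundary values. Jensen's inequality bounds the first nonzero coefficient: `4π log |c k| ≤ a⁻¹ ∫_Y
|f_N|² + |Y| log a + C` for every `a > 0`. Letting `N → ∞` and then taking `a` small is
contradictory. -/

instance isFiniteMeasure_lebesgueIco : IsFiniteMeasure lebesgueIco :=
  ⟨by rw [comap_subtype_coe_apply measurableSet_Ico, Set.image_univ, Subtype.range_coe,
    Real.volume_Ico]; exact ENNReal.ofReal_lt_top⟩

/-- The trigonometric polynomial `∑_{n < N} c n e^{-inx}`. -/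
noncomputable def antianalyticSum (c : ℕ → ℂ) (N : ℕ) (x : ℝ) : ℂ :=
  ∑ n ∈ Finset.range N, c n * Complex.exp (-(Complex.I * (n : ℂ) * (x : ℂ)))

lemma continuous_antianalyticSum (c : ℕ → ℂ) (N : ℕ) : Continuous (antianalyticSum c N) := by
  unfold antianalyticSum
  fun_prop

/-- Functions on `[0, 2π)` with a continuous extension to the line are integrable. -/
lemma integrable_lebesgueIco_of_continuous {E : Type*} [NormedAddCommGroup E] {f : ℝ → E}
    (hf : Continuous f) : Integrable (fun x : Set.Ico (0 : ℝ) (2 * Real.pi) => f x) lebesgueIco := by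
  have h := (integrableOn_iff_comap_subtypeVal measurableSet_Ico).mp
    ((hf.integrableOn_Icc (μ := volume) (a := 0) (b := 2 * Real.pi)).mono_set
      Set.Ico_subset_Icc_self)
  exact h

lemma integrable_norm_sq_antianalyticSum (c : ℕ → ℂ) (N : ℕ) :
    Integrable (fun x : Set.Ico (0 : ℝ) (2 * Real.pi) => ‖antianalyticSum c N x‖ ^ 2)
      lebesgueIco :=
  integrable_lebesgueIco_of_continuous (f := fun x => ‖antianalyticSum c N x‖ ^ 2)
    ((continuous_antianalyticSum c N).norm.pow 2)

/-! ### Jensen's inequality for polynomials on the unit circle -/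

/-- Jensen's inequality `log |lc p| ≤ (1 / 2π) ∫ log |p|` on the unit circle. -/
lemma log_norm_leadingCoeff_le_integral {p : Polynomial ℂ} (hp : p ≠ 0) :
    2 * Real.pi * Real.log ‖p.leadingCoeff‖ ≤
      ∫ x : Set.Ico (0 : ℝ) (2 * Real.pi), Real.log ‖p.eval (circleMap 0 1 x)‖ ∂lebesgueIco := by
  have h1 : Real.log ‖p.leadingCoeff‖ ≤ p.logMahlerMeasure := by
    rw [Polynomial.logMahlerMeasure_eq_log_MahlerMeasure]
    exact Real.log_le_log (norm_pos_iff.mpr (Polynomial.leadingCoeff_ne_zero.mpr hp))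
      p.leadingCoeff_le_mahlerMeasure
  rw [Polynomial.logMahlerMeasure_def, Real.circleAverage_def, smul_eq_mul,
    intervalIntegral.integral_of_le (by positivity), ← integral_Ico_eq_integral_Ioc,
    ← integral_subtype_comap measurableSet_Ico
      (fun x : ℝ => Real.log ‖p.eval (circleMap 0 1 x)‖)] at h1
  have hpi : 0 < 2 * Real.pi := by positivity
  calc _ ≤ 2 * Real.pi * _ := mul_le_mul_of_nonneg_left h1 hpi.le
    _ = _ := by rw [← mul_assoc, mul_inv_cancel₀ hpi.ne', one_mul]

lemma integrable_log_norm_eval_circleMap (p : Polynomial ℂ) :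
    Integrable (fun x : Set.Ico (0 : ℝ) (2 * Real.pi) => Real.log ‖p.eval (circleMap 0 1 x)‖)
      lebesgueIco := by
  have h := p.intervalIntegrable_mahlerMeasure
  rw [intervalIntegrable_iff_integrableOn_Ico_of_le (by positivity)] at h
  exact (integrableOn_iff_comap_subtypeVal measurableSet_Ico).mp h

lemma ae_eval_circleMap_ne_zero {p : Polynomial ℂ} (hp : p ≠ 0) :
    ∀ᵐ x : Set.Ico (0 : ℝ) (2 * Real.pi) ∂lebesgueIco, p.eval (circleMap 0 1 x) ≠ 0 := by
  have hfin : {x : Set.Ico (0 : ℝ) (2 * Real.pi) | p.eval (circleMap 0 1 x) = 0}.Finite := by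
    refine ((p.roots.finite_toSet).preimage
      (f := fun x : Set.Ico (0 : ℝ) (2 * Real.pi) => circleMap 0 1 x) ?_).subset ?_
    · intro x _ y _ hxy
      refine Subtype.ext (injOn_circleMap_of_abs_sub_le' one_ne_zero ?_ x.2 y.2 hxy)
      simp
    · intro x hx
      simpa [hp] using hx
  have h0 : lebesgueIco {x | p.eval (circleMap 0 1 x) = 0} = 0 := by
    rw [comap_subtype_coe_apply measurableSet_Ico]
    exact (hfin.image _).measure_zero _
  simpa [ae_iff] using h0

/-- This is `log u ≤ u - 1` at `u = t / a`, with the `-1` dropped. The free parameter `a` lets `log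
a` be made arbitrarily negative. -/
lemma log_le_div_add_log {t a : ℝ} (ht : 0 < t) (ha : 0 < a) :
    Real.log t ≤ a⁻¹ * t + Real.log a := by
  have h := Real.log_le_sub_one_of_pos (mul_pos (inv_pos.mpr ha) ht)
  rw [Real.log_mul (inv_pos.mpr ha).ne' ht.ne', Real.log_inv] at h
  linarith

/-- Jensen's inequality combined with `log t ≤ t / a + log a` on `Y` and `log t ≤ t` off `Y`. -/
lemma log_norm_leadingCoeff_le {p : Polynomial ℂ} (hp : p ≠ 0)
    {Y : Set (Set.Ico (0 : ℝ) (2 * Real.pi))} (hY : MeasurableSet Y) {a : ℝ} (ha : 0 < a) :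
    4 * Real.pi * Real.log ‖p.leadingCoeff‖ ≤
      a⁻¹ * (∫ x in Y, ‖p.eval (circleMap 0 1 x)‖ ^ 2 ∂lebesgueIco) +
      lebesgueIco.real Y * Real.log a +
      ∫ x in Yᶜ, ‖p.eval (circleMap 0 1 x)‖ ^ 2 ∂lebesgueIco := by
  have hint := integrable_log_norm_eval_circleMap p
  have hsq : Integrable (fun x : Set.Ico (0 : ℝ) (2 * Real.pi) =>
      ‖p.eval (circleMap 0 1 x)‖ ^ 2) lebesgueIco :=
    integrable_lebesgueIco_of_continuous (f := fun x => ‖p.eval (circleMap 0 1 x)‖ ^ 2)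
      ((p.continuous.comp (continuous_circleMap 0 1)).norm.pow 2)
  have hlog : ∀ x : Set.Ico (0 : ℝ) (2 * Real.pi),
      2 * Real.log ‖p.eval (circleMap 0 1 x)‖ = Real.log (‖p.eval (circleMap 0 1 x)‖ ^ 2) := by
    intro x
    rw [Real.log_pow]
    norm_num
  have hne := ae_eval_circleMap_ne_zero hp
  have h1 : ∫ x in Y, 2 * Real.log ‖p.eval (circleMap 0 1 x)‖ ∂lebesgueIco ≤
      a⁻¹ * (∫ x in Y, ‖p.eval (circleMap 0 1 x)‖ ^ 2 ∂lebesgueIco) +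
      lebesgueIco.real Y * Real.log a := by
    calc _ ≤ ∫ x in Y, (a⁻¹ * ‖p.eval (circleMap 0 1 x)‖ ^ 2 + Real.log a) ∂lebesgueIco := by
          refine integral_mono_ae (hint.const_mul 2).integrableOn
            ((hsq.const_mul a⁻¹).integrableOn.add (integrable_const _)) ?_
          filter_upwards [ae_restrict_of_ae hne] with x hx
          rw [hlog]
          exact log_le_div_add_log (by positivity) ha
      _ = _ := by
          rw [integral_add (hsq.const_mul a⁻¹).integrableOn (integrable_const _),
            integral_const_mul, setIntegral_const, smul_eq_mul]
  have h2 : ∫ x in Yᶜ, 2 * Real.log ‖p.eval (circleMap 0 1 x)‖ ∂lebesgueIco ≤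
      ∫ x in Yᶜ, ‖p.eval (circleMap 0 1 x)‖ ^ 2 ∂lebesgueIco := by
    refine integral_mono (hint.const_mul 2).integrableOn hsq.integrableOn fun x => ?_
    simp only [hlog]
    -- Zeros of `p` need no exclusion here, because `Real.log 0 = 0`.
    exact Real.log_le_self (by positivity)
  have h3 := integral_add_compl hY (hint.const_mul 2)
  rw [integral_const_mul 2 (μ := lebesgueIco)] at h3
  linarith [log_norm_leadingCoeff_le_integral hp]

/-! ### Uniqueness from a set of positive measure -/

/-- Multiplying by the unimodular factor `e^{iNx}` reverses the order of the coefficients, so the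
first nonzero one becomes the leading coefficient, the one Jensen's inequality controls. -/
lemma exists_polynomial_norm_eval_eq {c : ℕ → ℂ} {k N : ℕ} (hk : ∀ n < k, c n = 0)
    (hck : c k ≠ 0) (hN : k < N) :
    ∃ p : Polynomial ℂ, p.leadingCoeff = c k ∧
      ∀ x : ℝ, ‖p.eval (circleMap 0 1 x)‖ = ‖antianalyticSum c N x‖ := by
  let p : Polynomial ℂ := ∑ n ∈ Finset.range N, Polynomial.monomial (N - n) (c n)
  have hcoeff : p.coeff (N - k) = c k := by
    simp only [p, Polynomial.finsetSum_coeff, Polynomial.coeff_monomial]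
    rw [Finset.sum_eq_single k]
    · simp
    · intro n hn hnk
      have := Finset.mem_range.mp hn
      exact if_neg (by omega)
    · intro h
      exact absurd (Finset.mem_range.mpr hN) h
  have hdeg : p.natDegree ≤ N - k := by
    refine Polynomial.natDegree_sum_le_of_forall_le _ _ fun n _ => ?_
    by_cases hn : n < k
    · simp [hk n hn]
    · exact (Polynomial.natDegree_monomial_le _).trans (by omega)
  refine ⟨p, ?_, fun x => ?_⟩
  · rw [Polynomial.leadingCoeff, Polynomial.natDegree_eq_of_le_of_coeff_ne_zero hdeg
      (by rw [hcoeff]; exact hck), hcoeff]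
  · have h : p.eval (circleMap 0 1 x) =
        Complex.exp ((N * x : ℝ) * Complex.I) * antianalyticSum c N x := by
      simp only [p, antianalyticSum, Polynomial.eval_finsetSum, Polynomial.eval_monomial,
        Finset.mul_sum]
      refine Finset.sum_congr rfl fun n hn => ?_
      rw [circleMap_zero, Complex.ofReal_one, one_mul, ← Complex.exp_nat_mul, mul_left_comm _ (c n),
        ← Complex.exp_add, Nat.cast_sub (Finset.mem_range.mp hn).le]
      congr 2
      push_cast
      ring
    rw [h, norm_mul, Complex.norm_exp_ofReal_mul_I, one_mul]

/-- A Hardy space function that vanishes on a set of positive measure is zero, in terms of the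
partial sums of its Fourier series. -/
lemma eq_zero_of_tendsto_setIntegral_antianalyticSum {c : ℕ → ℂ} {C : ℝ}
    {Y : Set (Set.Ico (0 : ℝ) (2 * Real.pi))} (hY : MeasurableSet Y)
    (hpos : 0 < lebesgueIco.real Y)
    (hlim : Tendsto (fun N => ∫ x in Y, ‖antianalyticSum c N x‖ ^ 2 ∂lebesgueIco) atTop (𝓝 0))
    (hC : ∀ N, ∫ x, ‖antianalyticSum c N (x : Set.Ico (0 : ℝ) (2 * Real.pi))‖ ^ 2
      ∂lebesgueIco ≤ C) : ∀ n, c n = 0 := by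
  by_contra! hex
  classical
  let k := Nat.find hex
  have hck : c k ≠ 0 := Nat.find_spec hex
  have hk : ∀ n < k, c n = 0 := fun n hn => not_not.mp (Nat.find_min hex hn)
  have key : ∀ a : ℝ, 0 < a →
      4 * Real.pi * Real.log ‖c k‖ ≤ lebesgueIco.real Y * Real.log a + C := by
    intro a ha
    have ht : Tendsto (fun N => a⁻¹ * (∫ x in Y, ‖antianalyticSum c N x‖ ^ 2 ∂lebesgueIco) +
        (lebesgueIco.real Y * Real.log a + C)) atTop
        (𝓝 (a⁻¹ * 0 + (lebesgueIco.real Y * Real.log a + C))) :=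
      (hlim.const_mul _).add_const _
    rw [mul_zero, zero_add] at ht
    -- With `a` fixed, `N → ∞` removes the term `a⁻¹ ∫_Y`.
    refine ge_of_tendsto ht ?_
    filter_upwards [eventually_gt_atTop k] with N hN
    obtain ⟨p, hp, hpx⟩ := exists_polynomial_norm_eval_eq hk hck hN
    have h := log_norm_leadingCoeff_le (p := p)
      (Polynomial.leadingCoeff_ne_zero.mp (by rw [hp]; exact hck)) hY ha
    simp only [hp, hpx] at h
    have h2 : ∫ x in Yᶜ, ‖antianalyticSum c N x‖ ^ 2 ∂lebesgueIco ≤ C :=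
      (setIntegral_le_integral (integrable_norm_sq_antianalyticSum c N)
        (Eventually.of_forall fun x => by positivity)).trans (hC N)
    linarith
  -- This `a` makes the right side of `key` equal to `4π log ‖c k‖ - 1`.
  have h := key (Real.exp ((4 * Real.pi * Real.log ‖c k‖ - C - 1) / lebesgueIco.real Y))
    (Real.exp_pos _)
  rw [Real.log_exp, mul_div_cancel₀ _ hpos.ne'] at h
  linarith

/-! ### The quadratic form of the canonical phase -/

section CanonicalPhase

variable {H : Type*} [NormedAddCommGroup H] [InnerProductSpace ℂ H]

/-- `⟨φ | S φ⟩ = (1 / 2π) ∫_X |∑_{n < N} ⟨n|φ⟩ e^{-inx}|² dx` for the square partial sums `S`. -/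
lemma inner_canonicalPhasePartialSum (b : HilbertBasis ℕ ℂ H)
    (X : Set (Set.Ico (0 : ℝ) (2 * Real.pi))) (N : ℕ) (φ : H) :
    inner ℂ φ (canonicalPhasePartialSum b X N N φ) =
      (((2 * Real.pi)⁻¹ * ∫ x in X, ‖antianalyticSum (fun n => inner ℂ (b n) φ) N x‖ ^ 2
        ∂lebesgueIco : ℝ) : ℂ) := by
  have hpt : ∀ x : ℝ, ((‖antianalyticSum (fun n => inner ℂ (b n) φ) N x‖ ^ 2 : ℝ) : ℂ) =
      ∑ n ∈ Finset.range N, ∑ m ∈ Finset.range N, (inner ℂ φ (b n) * inner ℂ (b m) φ) *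
        Complex.exp (Complex.I * ((n : ℂ) - (m : ℂ)) * (x : ℂ)) := by
    intro x
    rw [Complex.ofReal_pow, ← Complex.conj_mul', antianalyticSum, map_sum, Finset.sum_mul_sum]
    refine Finset.sum_congr rfl fun n _ => Finset.sum_congr rfl fun m _ => ?_
    rw [map_mul, inner_conj_symm, ← Complex.exp_conj, mul_mul_mul_comm, ← Complex.exp_add]
    congr 2
    simp only [map_neg, map_mul, Complex.conj_I, map_natCast, Complex.conj_ofReal]
    ring
  have hint : ∀ n m : ℕ, Integrable (fun x : Set.Ico (0 : ℝ) (2 * Real.pi) =>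
      (inner ℂ φ (b n) * inner ℂ (b m) φ) *
        Complex.exp (Complex.I * ((n : ℂ) - (m : ℂ)) * ((x : ℝ) : ℂ)))
      (lebesgueIco.restrict X) := fun n m =>
    ((integrable_lebesgueIco_of_continuous (f := fun x : ℝ =>
      Complex.exp (Complex.I * ((n : ℂ) - (m : ℂ)) * (x : ℂ)))
      (by fun_prop)).const_mul _).integrableOn
  rw [Complex.ofReal_mul, ← integral_complex_ofReal]
  simp only [hpt]
  rw [integral_finsetSum _ fun n _ => integrable_finsetSum _ fun m _ => hint n m,
    Finset.mul_sum, canonicalPhasePartialSum, sum_apply, inner_sum]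
  refine Finset.sum_congr rfl fun n _ => ?_
  rw [integral_finsetSum _ fun m _ => hint n m, Finset.mul_sum, sum_apply, inner_sum]
  refine Finset.sum_congr rfl fun m _ => ?_
  rw [integral_const_mul, smul_apply, InnerProductSpace.rankOne_apply,
    inner_smul_right, inner_smul_right, canonicalPhaseCoeff]
  push_cast
  ring

lemma canonicalPhasePartialSum_univ_apply (b : HilbertBasis ℕ ℂ H) (N : ℕ) (φ : H) :
    canonicalPhasePartialSum b Set.univ N N φ =
      ∑ n ∈ Finset.range N, inner ℂ (b n) φ • b n := by
  rw [canonicalPhasePartialSum, sum_apply]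
  refine Finset.sum_congr rfl fun n hn => ?_
  simp [canonicalPhaseCoeff_univ, ite_smul, Finset.mem_range.mp hn]

/-- By orthonormality of the exponentials the left side is `∑_{n<N} |⟨n|φ⟩|²`, so this is Bessel's
inequality. -/
lemma integral_norm_sq_antianalyticSum_le (b : HilbertBasis ℕ ℂ H) (N : ℕ) (φ : H) :
    (2 * Real.pi)⁻¹ * ∫ x : Set.Ico (0 : ℝ) (2 * Real.pi),
      ‖antianalyticSum (fun n => inner ℂ (b n) φ) N x‖ ^ 2 ∂lebesgueIco ≤ ‖φ‖ ^ 2 := by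
  have h := inner_canonicalPhasePartialSum b Set.univ N φ
  rw [canonicalPhasePartialSum_univ_apply, Measure.restrict_univ, inner_sum] at h
  have h2 : ∑ n ∈ Finset.range N, inner ℂ φ (inner ℂ (b n) φ • b n) =
      ((∑ n ∈ Finset.range N, ‖inner ℂ (b n) φ‖ ^ 2 : ℝ) : ℂ) := by
    rw [Complex.ofReal_sum]
    refine Finset.sum_congr rfl fun n _ => ?_
    rw [inner_smul_right, ← inner_conj_symm φ (b n), Complex.mul_conj', Complex.ofReal_pow]
  rw [h2, Complex.ofReal_inj] at h
  rw [← h]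
  exact b.orthonormal.sum_inner_products_le φ

variable [CompleteSpace H]

lemma tendsto_setIntegral_antianalyticSum (b : HilbertBasis ℕ ℂ H)
    (X : Set (Set.Ico (0 : ℝ) (2 * Real.pi))) (φ : H) :
    Tendsto (fun N => (((2 * Real.pi)⁻¹ *
      ∫ x in X, ‖antianalyticSum (fun n => inner ℂ (b n) φ) N x‖ ^ 2 ∂lebesgueIco : ℝ) : ℂ))
      atTop (𝓝 (inner ℂ φ (canonicalPhase b X φ))) := by
  simp only [← inner_canonicalPhasePartialSum]
  have h := (tendsto_canonicalPhasePartialSum b X φ).comp tendsto_atTop_diagonal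
  simp only [Function.comp_def] at h
  exact tendsto_const_nhds.inner h

/-- The coefficients see `X` only up to null sets, and for the whole interval the square partial
sums are those of the expansion of `φ` in the basis. -/
lemma canonicalPhase_eq_id_of_compl_null (b : HilbertBasis ℕ ℂ H)
    {X : Set (Set.Ico (0 : ℝ) (2 * Real.pi))} (hX : lebesgueIco Xᶜ = 0) :
    canonicalPhase b X = ContinuousLinearMap.id ℂ H := by
  have hae : X =ᵐ[lebesgueIco] Set.univ := eventuallyEq_univ.mpr hX
  have hsum : ∀ k l, canonicalPhasePartialSum b X k l =
      canonicalPhasePartialSum b Set.univ k l := by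
    intro k l
    simp only [canonicalPhasePartialSum, canonicalPhaseCoeff, Measure.restrict_congr_set hae]
  ext φ
  have h1 := (tendsto_canonicalPhasePartialSum b X φ).comp tendsto_atTop_diagonal
  refine tendsto_nhds_unique h1 ?_
  have h2 := (b.hasSum_repr φ).tendsto_sum_nat
  refine h2.congr fun N => ?_
  simp only [Function.comp_apply, hsum, canonicalPhasePartialSum_univ_apply,
    b.repr_apply_apply]

end CanonicalPhase

theorem mainTheorem3 {H : Type*} [NormedAddCommGroup H] [InnerProductSpace ℂ H] [CompleteSpace H]
    (b : HilbertBasis ℕ ℂ H) (X : Set (Set.Ico (0 : ℝ) (2 * Real.pi))) (hX : MeasurableSet X)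
    (hne : canonicalPhase b X ≠ ContinuousLinearMap.id ℂ H) (φ : H) (hφ : ‖φ‖ = 1) :
    (inner ℂ φ (canonicalPhase b X φ)).im = 0 ∧ (inner ℂ φ (canonicalPhase b X φ)).re < 1 := by
  have hlim := tendsto_setIntegral_antianalyticSum b X φ
  have him := (Complex.continuous_im.tendsto _).comp hlim
  have hre := (Complex.continuous_re.tendsto _).comp hlim
  simp only [Function.comp_def, Complex.ofReal_im, Complex.ofReal_re] at him hre
  refine ⟨tendsto_nhds_unique him tendsto_const_nhds, ?_⟩
  by_contra! hge
  have hpi : 0 < 2 * Real.pi := by positivity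
  have htotal := fun N => integral_norm_sq_antianalyticSum_le b N φ
  simp only [hφ, one_pow] at htotal
  have hpos : 0 < lebesgueIco.real Xᶜ := by
    refine ENNReal.toReal_pos (fun h0 => hne (canonicalPhase_eq_id_of_compl_null b h0)) ?_
    exact measure_ne_top _ _
  have hcompl : Tendsto (fun N => ∫ x in Xᶜ,
      ‖antianalyticSum (fun n => inner ℂ (b n) φ) N x‖ ^ 2 ∂lebesgueIco) atTop (𝓝 0) := by
    have hle : ∀ N, (2 * Real.pi)⁻¹ * ∫ x in X,
        ‖antianalyticSum (fun n => inner ℂ (b n) φ) N x‖ ^ 2 ∂lebesgueIco ≤ 1 := fun N =>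
      (mul_le_mul_of_nonneg_left (setIntegral_le_integral
        (integrable_norm_sq_antianalyticSum _ N)
        (Eventually.of_forall fun x => by positivity)) (inv_pos.mpr hpi).le).trans (htotal N)
    -- The limit is at most `1` by Bessel and at least `1` by assumption.
    have hone := le_antisymm (le_of_tendsto' hre hle) hge
    rw [hone] at hre
    have hz := (hre.const_sub 1).const_mul (2 * Real.pi)
    rw [sub_self, mul_zero] at hz
    -- The integral over `Xᶜ` is the total, at most `2π`, minus the integral over `X`.
    refine squeeze_zero (fun N => integral_nonneg fun x => by positivity) (fun N => ?_) hz
    have hadd := integral_add_compl hX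
      (integrable_norm_sq_antianalyticSum (fun n => inner ℂ (b n) φ) N)
    have ht := (inv_mul_le_iff₀ hpi).mp (htotal N)
    rw [mul_sub, mul_inv_cancel_left₀ hpi.ne']
    linarith
  have hzero := eq_zero_of_tendsto_setIntegral_antianalyticSum (C := 2 * Real.pi * 1) hX.compl
    hpos hcompl fun N => (inv_mul_le_iff₀ hpi).mp (htotal N)
  have hφ0 : φ = 0 := by
    have hrepr : b.repr φ = 0 := by
      ext n
      simpa [b.repr_apply_apply] using hzero n
    simpa using hrepr
  simp [hφ0] at hφ
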